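/- Let $K$ be a CW complex, let $I=[0,1]$, and let $f:K\to K$ be a homotopy idempotent, that is, a continuous map such that $f\circ f$ is homotopic to $f$. Let $H:K\times I\to K$ be a homotopy from $f$ to $f\circ f$, so that $H(x,0)=f(x)$ and $H(x,1)=f(f(x))$. Let $\mathrm{Tel}(f)$ be the infinite telescope of $f$: the union, over all $n\in\mathbb Z$, of the unreduced mapping cylinders $M_n$ of $f:K_n\to K_{n+1}$ with $K_n=K$. In other words, it is the quotient space of $\bigsqcup_{n\in\mathbb Z}K\times I\times\{n\}$ obtained by identifying $(x,1,n)$ with $(f(x),0,n+1)$ for all $x\in K$ and $n\in\mathbb Z$; the subspace $K_n$ is the image of $K\times\{0\}\times\{n\}$. Define $d:K\to\mathrm{Tel}(f)$ by $d(x)=[f(x),0,0]$ (that is, $d$ is $f$ viewed as a map from $K$ to $K_0$), and $u:\mathrm{Tel}(f)\to K$ by $u([x,t,n])=H(x,t)$ (so $u=f$ on each $K_n$). Then for every finite CW complex $L$ and every continuous map $h:L\to\mathrm{Tel}(f)$, the map $d\circ u\circ h$ is (freely) homotopic to $h$. -/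

import Mathlib

open scoped unitInterval

/-- A homotopy idempotent: a map `f : K → K` such that `f ∘ f` is homotopic to `f`. -/
def IsHomotopyIdempotent {K : Type*} [TopologicalSpace K] (f : C(K, K)) : Prop :=
  (f.comp f).Homotopic f

/-- The gluing relation of the infinite telescope: the top `(x, 1)` of the `n`-th cylinder
`K n × I` is identified with the point `f n x` of the bottom `K (n + 1) × {0}` of the next one. -/
inductive TelescopeRel {K : ℤ → Type*} [∀ n, TopologicalSpace (K n)]
    (f : ∀ n, C(K n, K (n + 1))) : (Σ n, K n × I) → (Σ n, K n × I) → Prop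
  | glue (n : ℤ) (x : K n) : TelescopeRel f ⟨n, (x, 1)⟩ ⟨n + 1, (f n x, 0)⟩

/-- The infinite telescope of a two-sided sequence of maps `f n : K n → K (n + 1)`: the union of
the unreduced mapping cylinders `M n` of the `f n`, where the target end `K (n + 1)` of `M n` is
the source end of `M (n + 1)`. As every target end is the source end of the next cylinder, this is
the quotient of the disjoint union of the `K n × I` by `(x, 1) ∼ (f n x, 0)`. -/
def Telescope {K : ℤ → Type*} [∀ n, TopologicalSpace (K n)]
    (f : ∀ n, C(K n, K (n + 1))) : Type _ :=
  Quot (TelescopeRel f)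

/-- The telescope carries the quotient topology. -/
instance Telescope.instTopologicalSpace {K : ℤ → Type*} [∀ n, TopologicalSpace (K n)]
    (f : ∀ n, C(K n, K (n + 1))) : TopologicalSpace (Telescope f) :=
  inferInstanceAs (TopologicalSpace (Quot (TelescopeRel f)))

/-- The infinite telescope `Tel(f)` of a self-map: `K n = K` and `f n = f` for every `n`. -/
abbrev Tel {K : Type*} [TopologicalSpace K] (f : C(K, K)) : Type _ :=
  Telescope (K := fun _ : ℤ => K) (fun _ => f)

namespace Tel

/-- The canonical map of `K × I` onto the mapping cylinder `M n` in `Tel(f)`. -/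
def cyl {K : Type*} [TopologicalSpace K] (f : C(K, K)) (n : ℤ) : C(K × I, Tel f) where
  toFun p := Quot.mk _ ⟨n, p⟩
  continuous_toFun := continuous_quot_mk.comp continuous_sigmaMk

/-- The inclusion of `K` as the subspace `K n` of `Tel(f)`. -/
def incl {K : Type*} [TopologicalSpace K] (f : C(K, K)) (n : ℤ) : C(K, Tel f) :=
  (cyl f n).comp ((ContinuousMap.id K).prodMk (ContinuousMap.const K 0))

/-- The map `d : K → Tel(f)`, which is `f` from `K` to `K 0`. -/
def d {K : Type*} [TopologicalSpace K] (f : C(K, K)) : C(K, Tel f) :=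
  (incl f 0).comp f

/-- The map `u : Tel(f) → K` induced by a homotopy `H` from `f` to `f ∘ f`: it sends the point
`(x, t)` of each mapping cylinder `M n` to `H x t`. In particular it is `f` on each `K n`. -/
def u {K : Type*} [TopologicalSpace K] (f : C(K, K)) (H : f.Homotopy (f.comp f)) :
    C(Tel f, K) where
  toFun := Quot.lift (fun p : Σ _ : ℤ, K × I => H (p.2.2, p.2.1)) (by
    rintro _ _ ⟨n, x⟩
    simp)
  continuous_toFun := continuous_quot_lift _ (continuous_sigma fun _ => by fun_prop)

end Tel

namespace Tel

variable {K : Type*} [TopologicalSpace K] (f : C(K, K))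

/-! By compactness `h` has bounded height, so flowing upward deforms it into a single `K m`. One
more level of flow applies `f`, which is `u` on that `K m`; hence `h ≃ incl m ∘ g` with `g = u ∘ h`
(`exists_homotopic_incl_comp_u`). Applying `u` gives `g ≃ f ∘ g`. Since `incl n ≃ incl (n + 1) ∘ f`,
the level no longer matters, and `d ∘ u ∘ h = incl 0 ∘ f ∘ g ≃ incl 0 ∘ g ≃ incl m ∘ g ≃ h`. -/

theorem cyl_one (n : ℤ) (x : K) : cyl f n (x, 1) = cyl f (n + 1) (f x, 0) :=
  Quot.sound (TelescopeRel.glue (f := fun _ : ℤ => f) n x)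

theorem exists_cyl (z : Tel f) : ∃ n p, cyl f n p = z := by
  obtain ⟨⟨n, p⟩, rfl⟩ := Quot.exists_rep z
  exact ⟨n, p, rfl⟩

/-- The height of a point of the telescope: `n + t` at the point `(x, t)` of the `n`-th cylinder. -/
def height : C(Tel f, ℝ) where
  toFun := Quot.lift (fun p : Σ _ : ℤ, K × I => (p.1 : ℝ) + p.2.2) (by
    rintro _ _ ⟨n, x⟩
    simp)
  continuous_toFun := continuous_quot_lift _ (continuous_sigma fun _ => by fun_prop)

theorem height_cyl (n : ℤ) (p : K × I) : height f (cyl f n p) = n + p.2 := rfl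

/-- The flow from the `n`-th cylinder into the next one, by height `s`. -/
noncomputable def flow (n : ℤ) : C((K × I) × I, Tel f) where
  toFun q := if (q.1.2 + q.2 : ℝ) ≤ 1
    then cyl f n (q.1.1, Set.projIcc 0 1 zero_le_one (q.1.2 + q.2 : ℝ))
    else cyl f (n + 1) (f q.1.1, Set.projIcc 0 1 zero_le_one (q.1.2 + q.2 - 1 : ℝ))
  continuous_toFun := by
    refine Continuous.if_le ?_ ?_ (by fun_prop) (by fun_prop) ?_
    · exact (cyl f n).continuous.comp
        (Continuous.prodMk (by fun_prop) (continuous_projIcc.comp (by fun_prop)))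
    · exact (cyl f (n + 1)).continuous.comp
        (Continuous.prodMk (by fun_prop) (continuous_projIcc.comp (by fun_prop)))
    · intro q hq
      rw [hq, sub_self, Set.projIcc_right, Set.projIcc_left]
      exact cyl_one f n q.1.1

theorem flow_zero (n : ℤ) (p : K × I) : flow f n (p, 0) = cyl f n p := by
  simp [flow, p.2.2.2]

theorem flow_bot (n : ℤ) (x : K) (s : I) : flow f n ((x, 0), s) = cyl f n (x, s) := by
  simp [flow, s.2.2]

theorem flow_top (n : ℤ) (x : K) (s : I) : flow f n ((x, 1), s) = cyl f (n + 1) (f x, s) := by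
  rcases eq_or_ne s 0 with rfl | hs
  · rw [flow_zero, cyl_one]
  · have h0 : ¬ (1 + s : ℝ) ≤ 1 := by
      have := unitInterval.pos_iff_ne_zero.2 hs
      simpa using this
    simp [flow, h0]

theorem flow_one (n : ℤ) (x : K) (t : I) : flow f n ((x, t), 1) = cyl f (n + 1) (f x, t) := by
  rcases eq_or_ne t 0 with rfl | ht
  · rw [flow_bot, cyl_one]
  · have h0 : ¬ (t + 1 : ℝ) ≤ 1 := by
      have := unitInterval.pos_iff_ne_zero.2 ht
      simpa using this
    simp [flow, h0]

/-- The flow on the `n`-th cylinder, stopped when it reaches the top of the `m`-th cylinder. -/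
noncomputable def stoppedFlow (m n : ℤ) : C((K × I) × I, Tel f) :=
  if n < m then flow f n
  else if n = m then
    (cyl f n).comp ⟨fun q => (q.1.1, max q.1.2 q.2), by fun_prop⟩
  else (cyl f n).comp ⟨fun q => q.1, by fun_prop⟩

theorem stoppedFlow_of_lt {m n : ℤ} (h : n < m) : stoppedFlow f m n = flow f n := if_pos h

theorem stoppedFlow_self (m : ℤ) (p : K × I) (s : I) :
    stoppedFlow f m m (p, s) = cyl f m (p.1, max p.2 s) := by
  simp [stoppedFlow]

theorem stoppedFlow_of_gt {m n : ℤ} (h : m < n) (p : K × I) (s : I) :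
    stoppedFlow f m n (p, s) = cyl f n p := by
  simp [stoppedFlow, h.not_gt, h.ne']

theorem stoppedFlow_zero (m n : ℤ) (p : K × I) : stoppedFlow f m n (p, 0) = cyl f n p := by
  rcases lt_trichotomy n m with h | rfl | h
  · rw [stoppedFlow_of_lt f h, flow_zero]
  · rw [stoppedFlow_self, max_eq_left (show (0 : I) ≤ p.2 from p.2.2.1)]
  · rw [stoppedFlow_of_gt f h]

theorem stoppedFlow_glue (m n : ℤ) (x : K) (s : I) :
    stoppedFlow f m n ((x, 1), s) = stoppedFlow f m (n + 1) ((f x, 0), s) := by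
  rcases lt_trichotomy n m with h | rfl | h
  · rw [stoppedFlow_of_lt f h, flow_top]
    rcases (Int.add_one_le_iff.2 h).lt_or_eq with h' | rfl
    · rw [stoppedFlow_of_lt f h', flow_bot]
    · rw [stoppedFlow_self, max_eq_right (show (0 : I) ≤ s from s.2.1)]
  · rw [stoppedFlow_self, max_eq_left (show s ≤ (1 : I) from s.2.2),
      stoppedFlow_of_gt f (lt_add_one n), cyl_one]
  · rw [stoppedFlow_of_gt f h, stoppedFlow_of_gt f (h.trans (lt_add_one n)), cyl_one]

/-- The upward flow on the telescope which stops at the top of the `m`-th cylinder, as a map to the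
space of paths. -/
noncomputable def flowPath (m : ℤ) : C(Tel f, C(I, Tel f)) where
  -- Currying leaves the quotient alone in the source, so continuity does not require `Tel f × I` to
  -- carry a quotient topology.
  toFun := Quot.lift (fun p : Σ _ : ℤ, K × I => (stoppedFlow f m p.1).curry p.2) (by
    rintro _ _ ⟨n, x⟩
    ext s
    exact stoppedFlow_glue f m n x s)
  continuous_toFun :=
    continuous_quot_lift _ (continuous_sigma fun n => (stoppedFlow f m n).curry.continuous)

theorem flowPath_cyl (m n : ℤ) (p : K × I) (s : I) :
    flowPath f m (cyl f n p) s = stoppedFlow f m n (p, s) := rfl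

/-- The end of the flow which stops at the top of the `m`-th cylinder. -/
noncomputable def push (m : ℤ) : C(Tel f, Tel f) :=
  ⟨fun z => flowPath f m z 1, by fun_prop⟩

theorem id_homotopic_push (m : ℤ) : (ContinuousMap.id (Tel f)).Homotopic (push f m) :=
  ⟨{ toFun := fun q => flowPath f m q.2 q.1
     continuous_toFun := by fun_prop
     map_zero_left := fun z => by
      obtain ⟨n, p, rfl⟩ := exists_cyl f z
      exact stoppedFlow_zero f m n p
     map_one_left := fun _ => rfl }⟩

theorem push_cyl_of_lt {m n : ℤ} (h : n < m) (x : K) (t : I) :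
    push f m (cyl f n (x, t)) = cyl f (n + 1) (f x, t) :=
  (DFunLike.congr_fun (stoppedFlow_of_lt f h) _).trans (flow_one f n x t)

theorem push_cyl_self (m : ℤ) (x : K) (t : I) :
    push f m (cyl f m (x, t)) = incl f (m + 1) (f x) := by
  refine (stoppedFlow_self f m (x, t) 1).trans ?_
  rw [max_eq_right (show t ≤ (1 : I) from t.2.2)]
  exact cyl_one f m x

theorem push_incl (m : ℤ) (x : K) : push f m (incl f (m + 1) x) = incl f (m + 1) x :=
  stoppedFlow_of_gt f (lt_add_one m) (x, 0) 1

/-- A deformation of the telescope takes the cylinders between two levels to the upper level. -/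
theorem exists_deformation (m : ℤ) (k : ℕ) : ∃ e : C(Tel f, Tel f),
    (ContinuousMap.id (Tel f)).Homotopic e ∧
    (∀ x, e (incl f (m + 1) x) = incl f (m + 1) x) ∧
    ∀ n x t, m - k < n → n ≤ m → e (cyl f n (x, t)) ∈ Set.range (incl f (m + 1)) := by
  induction k with
  | zero => exact ⟨.id _, .refl _, fun _ => rfl, fun n x t h h' => by simp at h; omega⟩
  | succ k ih =>
    obtain ⟨e, he, hfix, hrange⟩ := ih
    -- `push` raises each cylinder below the `m`-th by one, and collapses the `m`-th onto a level
    -- that `e` fixes.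
    refine ⟨e.comp (push f m), he.comp (id_homotopic_push f m), fun x => ?_,
      fun n x t h h' => ?_⟩
    · rw [ContinuousMap.comp_apply, push_incl, hfix]
    · rw [ContinuousMap.comp_apply]
      rcases h'.lt_or_eq with h' | rfl
      · rw [push_cyl_of_lt f h']
        exact hrange _ _ _ (by push_cast at h; omega) h'
      · exact ⟨f x, by rw [push_cyl_self, hfix]⟩

theorem incl_homotopic_incl_succ_comp (n : ℤ) :
    (incl f n).Homotopic ((incl f (n + 1)).comp f) :=
  ⟨{ toFun := fun q => cyl f n (q.2, q.1)
     continuous_toFun := by fun_prop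
     map_zero_left := fun _ => rfl
     map_one_left := fun x => cyl_one f n x }⟩

theorem u_comp_incl (H : f.Homotopy (f.comp f)) (n : ℤ) : (u f H).comp (incl f n) = f :=
  ContinuousMap.ext fun x => H.apply_zero x

/-- A map of a compact space to the telescope is homotopic to a map to a single `K m`, factoring
through `u`. -/
theorem exists_homotopic_incl_comp_u (H : f.Homotopy (f.comp f)) {L : Type*} [TopologicalSpace L]
    [CompactSpace L] (h : C(L, Tel f)) :
    ∃ m : ℕ, h.Homotopic ((incl f m).comp ((u f H).comp h)) := by
  obtain ⟨C, hC⟩ := (isCompact_range ((height f).comp h).continuous).isBounded.exists_norm_le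
  obtain ⟨N, hN⟩ := exists_nat_ge C
  -- Heights in `[-N, N]` meet only cylinders with `-N - 1 ≤ n ≤ N`; `N - k < -N - 1` first holds at
  -- `k = 2 * N + 2`.
  obtain ⟨e, he, -, hrange⟩ := exists_deformation f N (2 * N + 2)
  have hmem (l : L) : e (h l) ∈ Set.range (incl f (N + 1)) := by
    obtain ⟨n, ⟨x, t⟩, hn⟩ := exists_cyl f (h l)
    have hl := abs_le.1 ((hC _ ⟨l, rfl⟩).trans hN)
    rw [ContinuousMap.comp_apply, ← hn, height_cyl] at hl
    have h0 := t.2.1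
    have h1 := t.2.2
    rw [← hn]
    refine hrange n x t ?_ ?_
    · have : -(N : ℝ) - 1 ≤ n := by linarith [hl.1]
      have : -(N : ℤ) - 1 ≤ n := by exact_mod_cast this
      push_cast
      omega
    · have : (n : ℝ) ≤ N := by linarith [hl.2]
      exact_mod_cast this
  have heh : h.Homotopic (e.comp h) := he.comp (.refl h)
  refine ⟨N + 2, heh.trans ?_⟩
  -- The extra push sends `incl (N + 1) x` to `incl (N + 2) (f x)`, and `f x` is `u` of the former
  -- point.
  refine .trans (g := (incl f (N + 1 + 1)).comp ((u f H).comp (e.comp h))) ?_ ?_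
  · refine ⟨{ toFun := fun q => flowPath f (N + 1) (e (h q.2)) q.1
              continuous_toFun := by fun_prop
              map_zero_left := fun l => ?_
              map_one_left := fun l => ?_ }⟩
    · obtain ⟨n, p, hp⟩ := exists_cyl f (e (h l))
      change flowPath f _ (e (h l)) 0 = e (h l)
      rw [← hp]
      exact stoppedFlow_zero f _ n p
    · obtain ⟨x, hx⟩ := hmem l
      change push f _ (e (h l)) = incl f _ (u f H (e (h l)))
      rw [← hx]
      refine (push_cyl_self f (N + 1) x 0).trans ?_
      rw [← ContinuousMap.comp_apply (u f H), u_comp_incl]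
  · have : ((N + 2 : ℕ) : ℤ) = N + 1 + 1 := by push_cast; ring
    rw [this]
    exact .comp (.refl _) (.comp (.refl _) heh.symm)

/-- If `f ∘ g ≃ g` then all the maps `g : L → K n` to the telescope are homotopic. -/
theorem incl_zero_comp_homotopic {L : Type*} [TopologicalSpace L] {g : C(L, K)}
    (hg : (f.comp g).Homotopic g) (m : ℕ) :
    ((incl f 0).comp g).Homotopic ((incl f m).comp g) := by
  induction m with
  | zero => exact .refl _
  | succ m ih =>
    refine ih.trans (.trans (.comp (incl_homotopic_incl_succ_comp f m) (.refl g)) ?_)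
    rw [Nat.cast_succ, ContinuousMap.comp_assoc]
    exact .comp (.refl (incl f (m + 1))) hg

theorem d_comp_u_comp_homotopic (H : f.Homotopy (f.comp f)) {L : Type*} [TopologicalSpace L]
    [CompactSpace L] (h : C(L, Tel f)) : (((d f).comp (u f H)).comp h).Homotopic h := by
  obtain ⟨m, hm⟩ := exists_homotopic_incl_comp_u f H h
  have hg : (f.comp ((u f H).comp h)).Homotopic ((u f H).comp h) := by
    -- Apply `u` to `hm`, using `u ∘ incl m = f`.
    have := ContinuousMap.Homotopic.comp (.refl (u f H)) hm.symm
    rwa [← ContinuousMap.comp_assoc, u_comp_incl] at this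
  exact (ContinuousMap.Homotopic.comp (.refl (incl f 0)) hg).trans
    ((incl_zero_comp_homotopic f hg m).trans hm.symm)

end Tel

/-- A finite CW complex is compact. -/
theorem Topology.CWComplex.isCompact_of_finite {X : Type*} [TopologicalSpace X] (C : Set X)
    [Topology.CWComplex C] [Topology.RelCWComplex.Finite C] : IsCompact C := by
  have := Topology.RelCWComplex.finite_cells_of_finite (C := C)
  have h := isCompact_iUnion fun i : Σ n, Topology.RelCWComplex.cell C n =>
    Topology.RelCWComplex.isCompact_closedCell (n := i.1) (i := i.2)
  rwa [Set.iUnion_sigma, Topology.CWComplex.union] at h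

theorem lemma2p6 {K L : Type*}
    [TopologicalSpace K] [T2Space K] [Topology.CWComplex (Set.univ : Set K)]
    (f : C(K, K)) (hf : IsHomotopyIdempotent f) (H : f.Homotopy (f.comp f))
    [TopologicalSpace L] [T2Space L] [Topology.CWComplex (Set.univ : Set L)]
    [Topology.RelCWComplex.Finite (Set.univ : Set L)]
    (h : C(L, Tel f)) :
    (((Tel.d f).comp (Tel.u f H)).comp h).Homotopic h := by
  have : CompactSpace L := ⟨Topology.CWComplex.isCompact_of_finite _⟩
  exact Tel.d_comp_u_comp_homotopic f H h
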